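/- Consider the following random graph process. Start with a single vertex and no edges. At step $n\ge 1$, choose two (not necessarily different) vertices $u,v$ among the $n$ existing ones, independently of each other and of all previous choices, each uniformly at random. Add a new vertex and connect it to $u$ and to all neighbours of $u$. Then delete all edges incident to $v$, except that an edge incident to the new vertex is not deleted (version 1 of the duplication--deletion model). Let $X[n,d]$ be the number of vertices of degree $d$ after $n$ steps, when the graph has $n+1$ vertices. Then there is a (deterministic) sequence $(c_d)_{d\ge 0}$ of positive numbers satisfying \[ c_0=\frac{1+c_1}{3},\qquad c_d=\frac{d+1}{2d+3}\bigl(c_{d-1}+c_{d+1}\bigr)\quad (d\ge 1), \] such that for every $d\ge 0$ \[ \frac{X[n,d]}{n+1}\longrightarrow c_d\qquad\text{almost surely as } n\to\infty . \] -/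

import Mathlib

open MeasureTheory ProbabilityTheory Filter Topology

namespace DuplicationDeletion

/-- Duplication: the vertices of `G` are `0, …, m - 1`; the new vertex `m` (`Fin.last m`) is
joined to the old vertex `u` and to all neighbours of `u`. -/
def duplicate {m : ℕ} (G : SimpleGraph (Fin m)) (u : Fin m) : SimpleGraph (Fin (m + 1)) :=
  G.map Fin.castSuccEmb ⊔
    SimpleGraph.fromRel fun x y =>
      x = Fin.last m ∧ ∃ i : Fin m, y = i.castSucc ∧ (i = u ∨ G.Adj u i)

/-- Erasure with protection of the new edges: all edges at the old vertex `v` are deleted, except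
for those that end in the new vertex `m` (`Fin.last m`). -/
def eraseProtected {m : ℕ} (H : SimpleGraph (Fin (m + 1))) (v : Fin m) :
    SimpleGraph (Fin (m + 1)) :=
  H.deleteEdges {e : Sym2 (Fin (m + 1)) | v.castSucc ∈ e ∧ Fin.last m ∉ e}

/-- The graph after `n` steps (version with protected new edges). It starts with a single vertex;
in step `n + 1` the old vertex `u n` is duplicated, and then the edges of the old vertex `v n`
are erased. -/
def graph (u v : (n : ℕ) → Fin (n + 1)) : (n : ℕ) → SimpleGraph (Fin (n + 1))
  | 0 => ⊥
  | n + 1 => eraseProtected (duplicate (graph u v n) (u n)) (v n)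

open Classical in
/-- The number of vertices of degree `d`. -/
noncomputable def degreeCount {m : ℕ} (G : SimpleGraph (Fin m)) (d : ℕ) : ℕ :=
  (Finset.univ.filter fun x : Fin m => G.degree x = d).card

/-- In every step two old vertices are chosen uniformly at random, independently of each other,
and independently over the steps. `U n` and `V n` are the choices of step `n + 1`, when there are
`n + 1` old vertices. -/
structure IsRandomChoice {Ω : Type*} [MeasurableSpace Ω] (μ : Measure Ω)
    (U V : (n : ℕ) → Ω → Fin (n + 1)) : Prop where
  measurable_fst : ∀ n, Measurable (U n)
  measurable_snd : ∀ n, Measurable (V n)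
  uniform_fst : ∀ (n : ℕ) (a : Fin (n + 1)), μ (U n ⁻¹' {a}) = ((n : ENNReal) + 1)⁻¹
  uniform_snd : ∀ (n : ℕ) (a : Fin (n + 1)), μ (V n ⁻¹' {a}) = ((n : ENNReal) + 1)⁻¹
  indep_within_step : ∀ n, IndepFun (U n) (V n) μ
  indep_steps : iIndepFun (fun (n : ℕ) (ω : Ω) => (U n ω, V n ω)) μ

/-- `X[n, d]`: the number of vertices of degree `d` after `n` steps, as a random variable. -/
noncomputable def X {Ω : Type*} (U V : (n : ℕ) → Ω → Fin (n + 1)) (n d : ℕ) (ω : Ω) : ℕ :=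
  degreeCount (graph (fun k => U k ω) (fun k => V k ω) n) d

end DuplicationDeletion

namespace DuplicationDeletion

/-! With `m` vertices, averaging over both choices changes the number of vertices of degree `d` by
`(d + 1) / m` times a discrete second difference in `d`, up to an error governed by the degree sum
(`abs_drift_le`). Every erased vertex tends to become isolated, so at `d = 0` the missing left
neighbour is the count of all vertices; shifting indices by one makes this a boundary value `1`.

The limit is the bounded solution of the stationary equation (`exists_stationary`). For convergence,
let `z j` be the limsup of the deviation of the `j`-th proportion. The recursion is damped strongly
enough that `z` is a subsolution of the homogeneous equation with `z 0 = 0`; such a sequence is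
convex and bounded, hence zero (`tendsto_of_perturbed_recursion`, `eq_zero_of_subsolution`). This
argument is pathwise.

Probability enters in showing that the perturbations are negligible. The degree sum has mean `2n`,
and the sum of squared degrees has mean at most `15n`. The martingale differences of the counts
therefore have bounded second moments and obey a strong law (`ae_tendsto_sum_div_of_orthogonal`),
and the drift error vanishes almost surely (`ae_tendsto_degreeSum_div_sq`). -/

open Classical in
/-- The degree of a vertex, as a sum of indicators. -/
noncomputable def deg {m : ℕ} (G : SimpleGraph (Fin m)) (x : Fin m) : ℕ :=
  ∑ y, if G.Adj x y then 1 else 0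

/-- The graph after one step, with choices `u` and `v`. -/
def step {m : ℕ} (G : SimpleGraph (Fin m)) (u v : Fin m) : SimpleGraph (Fin (m + 1)) :=
  eraseProtected (duplicate G u) v

/-- The sum of `f (deg x)` over all vertices `x`. -/
noncomputable def degSum {m : ℕ} (G : SimpleGraph (Fin m)) (f : ℕ → ℝ) : ℝ :=
  ∑ x, f (deg G x)

lemma degreeCount_eq_degSum {m : ℕ} (G : SimpleGraph (Fin m)) (d : ℕ) :
    (degreeCount G d : ℝ) = degSum G fun k => if k = d then 1 else 0 := by
  classical
  -- Quantifying over the instance lets the rewrite match whichever one `degreeCount` carries.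
  have h : ∀ x, ∀ _ : Fintype (G.neighborSet x), G.degree x = deg G x := by
    intro x _
    rw [deg, ← Finset.card_filter, ← SimpleGraph.card_neighborFinset_eq_degree]
    congr 1
    ext y
    simp
  unfold degreeCount degSum
  rw [Finset.card_filter]
  push_cast
  exact Finset.sum_congr rfl fun x _ => by rw [h x]

/-! ### One step of the process: degrees, drift and size of the change -/

section Step

variable {m : ℕ} (G : SimpleGraph (Fin m)) (u v : Fin m)

lemma step_adj_castSucc (x y : Fin m) :
    (step G u v).Adj x.castSucc y.castSucc ↔ G.Adj x y ∧ x ≠ v ∧ y ≠ v := by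
  have h1 : ∀ z : Fin m, Fin.last m ≠ z.castSucc := fun z => (Fin.castSucc_lt_last z).ne'
  simp only [step, eraseProtected, duplicate, SimpleGraph.deleteEdges_adj, SimpleGraph.sup_adj,
    SimpleGraph.fromRel_adj, SimpleGraph.map_adj, Set.mem_ofPred_eq, Sym2.mem_iff]
  constructor
  · rintro ⟨⟨a, b, hab, ha, hb⟩ | ⟨-, ⟨h, -⟩ | ⟨h, -⟩⟩, h2⟩
    · have ha' : a = x := Fin.castSucc_injective m ha
      have hb' : b = y := Fin.castSucc_injective m hb
      subst ha' hb'
      refine ⟨hab, ?_, ?_⟩ <;> rintro rfl <;> exact h2 ⟨by simp, by simp [h1]⟩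
    · exact absurd h.symm (h1 _)
    · exact absurd h.symm (h1 _)
  · rintro ⟨h, hx, hy⟩
    refine ⟨Or.inl ⟨x, y, h, rfl, rfl⟩, fun hh => ?_⟩
    rcases hh.1 with h' | h'
    · exact hx (Fin.castSucc_injective m h').symm
    · exact hy (Fin.castSucc_injective m h').symm

lemma step_adj_last (x : Fin m) :
    (step G u v).Adj x.castSucc (Fin.last m) ↔ x = u ∨ G.Adj u x := by
  have h1 : ∀ z : Fin m, Fin.last m ≠ z.castSucc := fun z => (Fin.castSucc_lt_last z).ne'
  simp only [step, eraseProtected, duplicate, SimpleGraph.deleteEdges_adj, SimpleGraph.sup_adj,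
    SimpleGraph.fromRel_adj, SimpleGraph.map_adj, Set.mem_ofPred_eq, Sym2.mem_iff]
  constructor
  · rintro ⟨⟨a, b, hab, ha, hb⟩ | ⟨-, ⟨h, -⟩ | ⟨-, i, hi, h⟩⟩, h2⟩
    · exact absurd hb.symm (h1 _)
    · exact absurd h.symm (h1 _)
    · rw [Fin.castSucc_injective m hi]; exact h
  · intro h
    exact ⟨Or.inr ⟨(h1 x).symm, Or.inr ⟨by trivial, x, rfl, h⟩⟩, fun hh => hh.2 (by simp)⟩

open Classical in
lemma sum_closedNbhd (x : Fin m) (A B : ℝ) :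
    ∑ w, (if x = w ∨ G.Adj w x then A else B) = (deg G x + 1) * A + (m - deg G x - 1) * B := by
  have h : ∀ w, (if x = w ∨ G.Adj w x then A else B)
      = (A - B) * (if x = w then 1 else 0) + (A - B) * (if G.Adj x w then 1 else 0) + B := by
    intro w
    by_cases h1 : x = w
    · subst h1; simp
    · simp only [h1, false_or, G.adj_comm w x, if_false]; split_ifs <;> simp
  simp only [h, Finset.sum_add_distrib, ← Finset.mul_sum, deg]
  push_cast
  simp
  ring

open Classical in
lemma sum_trichotomy (x : Fin m) (A B C : ℝ) :
    ∑ w, (if x = w then A else if G.Adj x w then B else C)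
      = A + deg G x * B + (m - 1 - deg G x) * C := by
  have h : ∀ w, (if x = w then A else if G.Adj x w then B else C)
      = (A - C) * (if x = w then 1 else 0) + (B - C) * (if G.Adj x w then 1 else 0) + C := by
    intro w
    by_cases h1 : x = w
    · subst h1; simp
    · simp only [h1, if_false]; split_ifs <;> simp
  simp only [h, Finset.sum_add_distrib, ← Finset.mul_sum, deg]
  push_cast
  simp
  ring

-- Protection makes the two effects additive: erasure acts on old edges only, and the edge to the
-- new vertex survives even when `x = v`.
open Classical in
lemma deg_step_castSucc (x : Fin m) :
    deg (step G u v) x.castSucc =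
      (if x = v then 0 else if G.Adj x v then deg G x - 1 else deg G x) +
        if x = u ∨ G.Adj u x then 1 else 0 := by
  rw [deg, Fin.sum_univ_castSucc]
  simp only [step_adj_castSucc, step_adj_last]
  congr 1
  by_cases hx : x = v
  · simp [hx]
  · have h : ∀ w, (if G.Adj x w then 1 else 0)
      = (if G.Adj x w ∧ x ≠ v ∧ w ≠ v then 1 else 0)
        + (if v = w then (if G.Adj x v then 1 else 0) else 0) := by
      intro w
      by_cases h1 : v = w
      · subst h1; simp
      · simp [hx, h1, Ne.symm h1]
    have h2 : deg G x = ∑ w, (if G.Adj x w ∧ x ≠ v ∧ w ≠ v then 1 else 0)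
        + if G.Adj x v then 1 else 0 := by
      rw [deg, Finset.sum_congr rfl fun w _ => h w, Finset.sum_add_distrib]
      simp
    rw [if_neg hx]
    split_ifs at h2 ⊢ <;> omega

lemma deg_step_last : deg (step G u v) (Fin.last m) = deg G u + 1 := by
  classical
  rw [deg, Fin.sum_univ_castSucc]
  simp only [(step G u v).adj_comm (Fin.last m), step_adj_last, SimpleGraph.irrefl, if_false,
    add_zero]
  have h : ∀ w, (if w = u ∨ G.Adj u w then 1 else 0)
      = (if u = w then 1 else 0) + (if G.Adj u w then 1 else 0) := by
    intro w
    by_cases h1 : u = w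
    · subst h1; simp
    · simp [h1, Ne.symm h1]
  rw [Finset.sum_congr rfl fun w _ => h w, Finset.sum_add_distrib, deg]
  simp [add_comm]

lemma degSum_step (f : ℕ → ℝ) :
    degSum (step G u v) f = (∑ x : Fin m, f (deg (step G u v) x.castSucc)) + f (deg G u + 1) := by
  rw [degSum, Fin.sum_univ_castSucc, deg_step_last]

/-- The contribution of a vertex of degree `D` to the sum of `degSum (step G u v) f` over all pairs
of choices `u`, `v`. -/
noncomputable def contribution (m D : ℕ) (f : ℕ → ℝ) : ℝ :=
  m * f (D + 1) + ((D + 1) * f 1 + (m - D - 1) * f 0) + D * ((D + 1) * f D + (m - D - 1) * f (D - 1))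
    + (m - 1 - D) * ((D + 1) * f (D + 1) + (m - D - 1) * f D)

/-- The summands of `contribution` correspond to: the copy of `x` when `u = x`, then the fate of `x`
itself when `v = x`, when `v` is a neighbour of `x`, and when `v` is elsewhere. In each of the
latter cases `D + 1` choices of `u` add an edge to `x`. -/
lemma sum_degSum_step (f : ℕ → ℝ) :
    ∑ u, ∑ v, degSum (step G u v) f = ∑ x, contribution m (deg G x) f := by
  classical
  have key : ∀ x, ∑ u, ∑ v, f (deg (step G u v) x.castSucc)
      = contribution m (deg G x) f - m * f (deg G x + 1) := by
    intro x
    rw [Finset.sum_comm]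
    have h1 : ∀ v, ∑ u, f (deg (step G u v) x.castSucc)
        = if x = v then (deg G x + 1) * f (0 + 1) + (m - deg G x - 1) * f 0
          else if G.Adj x v then
            (deg G x + 1) * f (deg G x - 1 + 1) + (m - deg G x - 1) * f (deg G x - 1)
          else (deg G x + 1) * f (deg G x + 1) + (m - deg G x - 1) * f (deg G x) := by
      intro v
      simp only [deg_step_castSucc]
      generalize hE : (if x = v then 0 else if G.Adj x v then deg G x - 1 else deg G x) = e
      have : ∀ u, f (e + if x = u ∨ G.Adj u x then 1 else 0)
          = if x = u ∨ G.Adj u x then f (e + 1) else f e := by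
        intro u; split_ifs <;> simp
      simp only [this, sum_closedNbhd]
      subst hE
      split_ifs <;> rfl
    simp only [h1, sum_trichotomy, contribution]
    -- At degree `0` the truncated `deg G x - 1` is harmless, since its term carries the factor `deg
    -- G x`.
    rcases Nat.eq_zero_or_pos (deg G x) with h0 | h0
    · simp [h0]; ring
    · rw [Nat.sub_add_cancel h0]
      simp
      ring
  simp only [degSum_step, Finset.sum_add_distrib]
  have h2 : ∑ u, ∑ v, ∑ x : Fin m, f (deg (step G u v) x.castSucc)
      = ∑ x, (contribution m (deg G x) f - m * f (deg G x + 1)) := by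
    simp only [← key]
    rw [Finset.sum_congr rfl fun v _ => Finset.sum_comm, Finset.sum_comm]
  rw [h2, Finset.sum_sub_distrib]
  simp only [Finset.sum_const, Finset.card_univ, Fintype.card_fin, nsmul_eq_mul,
    ← Finset.mul_sum]
  ring

lemma deg_lt (x : Fin m) : deg G x + 1 ≤ m := by
  classical
  have h : deg G x ≤ ∑ w : Fin m, if w = x then 0 else 1 :=
    Finset.sum_le_sum fun w _ => by
      by_cases h : w = x
      · subst h; simp
      · simp only [h, if_false]; split_ifs <;> simp
  have h2 : ∑ w : Fin m, (if w = x then 0 else 1) + 1 = m := by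
    have : ∀ w : Fin m, (if w = x then 0 else 1) + (if w = x then 1 else 0) = 1 := by
      intro w; split_ifs <;> rfl
    have h3 := Finset.sum_congr (rfl : (Finset.univ : Finset (Fin m)) = _) fun w _ => this w
    rw [Finset.sum_add_distrib] at h3
    simpa using h3
  omega

/-- The model is critical: a step changes the degree sum by `2 (deg u + 1) - 2 deg v`, whose average
is `2`. -/
lemma contribution_id (m D : ℕ) :
    contribution m D (fun k => (k : ℝ)) = m ^ 2 * D + 2 * m := by
  unfold contribution
  rcases D with _ | D <;> push_cast <;> simp <;> ring

lemma contribution_sq_le (m D : ℕ) (h : D + 1 ≤ m) :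
    contribution m D (fun k => (k : ℝ) ^ 2) ≤ m ^ 2 * D ^ 2 + m * (6 * D + 3) := by
  have h' : (D : ℝ) + 1 ≤ m := by exact_mod_cast h
  have : contribution m D (fun k => (k : ℝ) ^ 2)
      = m ^ 2 * D ^ 2 + m * (2 * D + 1) + (m - 1 - D) * (4 * D + 1) + (D + 1) := by
    unfold contribution
    rcases D with _ | D <;> push_cast <;> simp <;> ring
  rw [this]
  nlinarith [mul_nonneg (Nat.cast_nonneg (α := ℝ) D) (by positivity : (0:ℝ) ≤ D + 1)]

/-- The alternative `d = 0` in the indicator records that any vertex chosen as `v` drops to degree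
`0` unless `u` lies in its closed neighbourhood; those `D + 1` exceptions produce the term `D + 1`
of the error. -/
lemma abs_contribution_indicator_sub_le (m D d : ℕ) :
    |contribution m D (fun k => if k = d then 1 else 0)
      - (m ^ 2 * (if D = d then 1 else 0)
        + m * ((d + 1) * ((if d = 0 ∨ D + 1 = d then 1 else 0) + (if D = d + 1 then 1 else 0))
          - 2 * (d + 1) * (if D = d then 1 else 0)))|
      ≤ (D : ℝ) + 1 + 4 * (d + 2) ^ 2 := by
  have hd : (0 : ℝ) ≤ d := Nat.cast_nonneg d
  have hD : (0 : ℝ) ≤ D := Nat.cast_nonneg D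
  have a1 : |((if 1 = d then 1 else 0) - (if 0 = d then 1 else 0) : ℝ)| ≤ 1 := by
    split_ifs <;> simp
  have hz : ((d : ℝ) + 1) * (if d = 0 ∨ D + 1 = d then 1 else 0)
      = (d + 1) * (if D + 1 = d then 1 else 0) + (if 0 = d then 1 else 0) := by
    rcases d with _ | d <;> simp
  -- On the support of each indicator, `D` is determined by `d`. These identities remove `D` from
  -- the products, leaving an expression linear in the indicators in which the terms with `m`
  -- cancel.
  have hp : (if D = d then 1 else 0) * (D : ℝ) = (if D = d then 1 else 0) * d := by
    split_ifs with h <;> simp [h]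
  have hq : (if D + 1 = d then 1 else 0) * (D : ℝ) = (if D + 1 = d then 1 else 0) * (d - 1) := by
    split_ifs with h
    · rw [← h]; push_cast; ring
    · simp
  have hr : (if D = d + 1 then 1 else 0) * (D : ℝ) = (if D = d + 1 then 1 else 0) * (d + 1) := by
    split_ifs with h <;> simp [h]
  have hs : (if D - 1 = d then 1 else 0) * (D : ℝ) = (d + 1) * (if D = d + 1 then 1 else 0) := by
    rcases D with _ | D
    · simp
    · by_cases h : D = d <;> simp [h]
  have hp' : (0 : ℝ) ≤ (if D = d then 1 else 0) ∧ (if D = d then 1 else 0) ≤ (1 : ℝ) := by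
    split_ifs <;> simp
  have hq' : (0 : ℝ) ≤ (if D + 1 = d then 1 else 0) ∧ (if D + 1 = d then 1 else 0) ≤ (1 : ℝ) := by
    split_ifs <;> simp
  have hr' : (0 : ℝ) ≤ (if D = d + 1 then 1 else 0) ∧ (if D = d + 1 then 1 else 0) ≤ (1 : ℝ) := by
    split_ifs <;> simp
  unfold contribution
  beta_reduce
  generalize (if D = d then 1 else 0 : ℝ) = p at *
  generalize (if D + 1 = d then 1 else 0 : ℝ) = q at *
  generalize (if D = d + 1 then 1 else 0 : ℝ) = r at *
  generalize (if D - 1 = d then 1 else 0 : ℝ) = s at *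
  generalize (if 1 = d then 1 else 0 : ℝ) = o at *
  generalize (if 0 = d then 1 else 0 : ℝ) = z at *
  generalize (if d = 0 ∨ D + 1 = d then 1 else 0 : ℝ) = w at *
  have expand : m * q + ((D + 1) * o + (m - D - 1) * z) + D * ((D + 1) * p + (m - D - 1) * s)
      + (m - 1 - D) * ((D + 1) * q + (m - D - 1) * p)
      - (m ^ 2 * p + m * ((d + 1) * (w + r) - 2 * (d + 1) * p))
      = (D + 1) * (o - z) + (2 * d + 1) * (d + 1) * p - (d + 1) * (d + 2) * r - d ^ 2 * q := by
    linear_combination (m - D - 1 : ℝ) * hs - (d + 1 : ℝ) * hr + (m - (D + 1 + d) : ℝ) * hq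
      + (2 * (D + d) + 3 - 2 * m : ℝ) * hp - (m : ℝ) * hz
  rw [expand, abs_le]
  have a2 := abs_le.1 a1
  have b1 := mul_le_mul_of_nonneg_left a2.1 (by positivity : (0:ℝ) ≤ D + 1)
  have b2 := mul_le_mul_of_nonneg_left a2.2 (by positivity : (0:ℝ) ≤ D + 1)
  have p1 := mul_le_mul_of_nonneg_left hp'.2 (by positivity : (0:ℝ) ≤ (2 * d + 1) * (d + 1))
  have p2 := mul_nonneg (by positivity : (0:ℝ) ≤ (2 * d + 1) * (d + 1)) hp'.1
  have q1 := mul_le_mul_of_nonneg_left hq'.2 (by positivity : (0:ℝ) ≤ (d : ℝ) ^ 2)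
  have q2 := mul_nonneg (by positivity : (0:ℝ) ≤ (d : ℝ) ^ 2) hq'.1
  have r1 := mul_le_mul_of_nonneg_left hr'.2 (by positivity : (0:ℝ) ≤ ((d:ℝ) + 1) * (d + 2))
  have r2 := mul_nonneg (by positivity : (0:ℝ) ≤ ((d:ℝ) + 1) * (d + 2)) hr'.1
  constructor <;> nlinarith

/-- The number of vertices of degree `j - 1` if `j > 0`, and the number of all vertices if
`j = 0`. -/
noncomputable def shiftedCount (j : ℕ) : ℝ :=
  degSum G fun k => if j = 0 ∨ k + 1 = j then 1 else 0

lemma shiftedCount_zero : shiftedCount G 0 = m := by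
  simp [shiftedCount, degSum]

lemma shiftedCount_succ (d : ℕ) : shiftedCount G (d + 1) = degreeCount G d := by
  simp [degreeCount_eq_degSum, shiftedCount]

lemma shiftedCount_nonneg (j : ℕ) : 0 ≤ shiftedCount G j := by
  unfold shiftedCount degSum
  exact Finset.sum_nonneg fun x _ => by beta_reduce; split_ifs <;> simp

lemma shiftedCount_le (j : ℕ) : shiftedCount G j ≤ m := by
  have : shiftedCount G j ≤ ∑ _x : Fin m, (1 : ℝ) := by
    unfold shiftedCount degSum
    exact Finset.sum_le_sum fun x _ => by beta_reduce; split_ifs <;> simp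
  simpa using this

lemma abs_drift_le [NeZero m] (d : ℕ) :
    |((m : ℝ) ^ 2)⁻¹ * ∑ u, ∑ v, shiftedCount (step G u v) (d + 1) - shiftedCount G (d + 1)
      - (d + 1) * (shiftedCount G d + shiftedCount G (d + 2) - 2 * shiftedCount G (d + 1)) / m|
      ≤ (degSum G (fun k => (k : ℝ)) + m * (1 + 4 * (d + 2) ^ 2)) / m ^ 2 := by
  have hm : (0 : ℝ) < m := by exact_mod_cast Nat.pos_of_ne_zero (NeZero.ne m)
  have h : ((m : ℝ) ^ 2)⁻¹ * ∑ u, ∑ v, shiftedCount (step G u v) (d + 1) - shiftedCount G (d + 1)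
      - (d + 1) * (shiftedCount G d + shiftedCount G (d + 2) - 2 * shiftedCount G (d + 1)) / m
      = (∑ x, (contribution m (deg G x) (fun k => if k = d then 1 else 0)
      - (m ^ 2 * (if deg G x = d then 1 else 0)
        + m * ((d + 1) * ((if d = 0 ∨ deg G x + 1 = d then 1 else 0)
          + (if deg G x = d + 1 then 1 else 0))
          - 2 * (d + 1) * (if deg G x = d then 1 else 0))))) / m ^ 2 := by
    simp only [Finset.sum_sub_distrib, Finset.sum_add_distrib, ← Finset.mul_sum,
      ← sum_degSum_step]
    simp only [shiftedCount, degSum, Nat.add_eq_zero_iff, one_ne_zero, and_false, false_or,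
      OfNat.ofNat_ne_zero, Nat.add_right_cancel_iff, show ∀ k, k + 1 = d + 2 ↔ k = d + 1 by omega]
    field_simp
    ring
  rw [h, abs_div, abs_of_pos (by positivity : (0 : ℝ) < m ^ 2)]
  gcongr
  refine (Finset.abs_sum_le_sum_abs _ _).trans
    ((Finset.sum_le_sum fun x _ => abs_contribution_indicator_sub_le m (deg G x) d).trans ?_)
  simp only [Finset.sum_add_distrib, degSum]
  simp
  linarith

/-- Only the closed neighbourhoods of `u` and `v` can change degree, and one vertex is new: `(deg u
+ 1) + (deg v + 1) + 1`. -/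
lemma abs_shiftedCount_step_sub_le (d : ℕ) :
    |shiftedCount (step G u v) (d + 1) - shiftedCount G (d + 1)| ≤ deg G u + deg G v + 3 := by
  classical
  simp only [shiftedCount, degSum_step, Nat.add_eq_zero_iff, one_ne_zero, and_false, false_or,
    Nat.add_right_cancel_iff]
  rw [degSum, add_sub_right_comm, ← Finset.sum_sub_distrib]
  refine (abs_add_le _ _).trans ?_
  have h1 : |(if deg G u + 1 = d then 1 else 0 : ℝ)| ≤ 1 := by split_ifs <;> simp
  have h2 : |∑ x : Fin m, ((if deg (step G u v) x.castSucc = d then 1 else 0)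
      - (if deg G x = d then 1 else 0) : ℝ)| ≤ ∑ x : Fin m, (((if x = v then 1 else 0)
        + (if G.Adj v x then 1 else 0)) + ((if x = u then 1 else 0)
        + (if G.Adj u x then 1 else 0)) : ℝ) := by
    refine (Finset.abs_sum_le_sum_abs _ _).trans (Finset.sum_le_sum fun x _ => ?_)
    rw [deg_step_castSucc, G.adj_comm v x]
    by_cases a1 : x = v
    · have : (0 : ℝ) ≤ (if G.Adj x v then 1 else 0) + ((if x = u then 1 else 0)
        + (if G.Adj u x then 1 else 0)) := by positivity
      rw [if_pos a1]
      refine le_trans (b := 1) ?_ (by rw [if_pos a1]; linarith)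
      split_ifs <;> simp
    by_cases a2 : G.Adj x v
    · have : (0 : ℝ) ≤ (if x = v then 1 else 0) + ((if x = u then 1 else 0)
        + (if G.Adj u x then 1 else 0)) := by positivity
      refine le_trans (b := 1) ?_ (by rw [if_pos a2]; linarith)
      generalize (if x = v then 0 else if G.Adj x v then deg G x - 1 else deg G x)
        + (if x = u ∨ G.Adj u x then 1 else 0) = e
      split_ifs <;> simp
    by_cases a3 : x = u ∨ G.Adj u x
    · refine le_trans (b := 1) ?_ ?_
      · generalize (if x = v then 0 else if G.Adj x v then deg G x - 1 else deg G x)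
          + (if x = u ∨ G.Adj u x then 1 else 0) = e
        split_ifs <;> simp
      · rcases a3 with a3 | a3 <;> simp only [a1, a2, a3, if_true, if_false]
          <;> split_ifs <;> norm_num
    · have a4 := not_or.1 a3
      simp [a1, a2, a4.1, a4.2]
  have h3 : ∑ x : Fin m, (((if x = v then 1 else 0)
        + (if G.Adj v x then 1 else 0)) + ((if x = u then 1 else 0)
        + (if G.Adj u x then 1 else 0)) : ℝ) = deg G u + deg G v + 2 := by
    simp only [Finset.sum_add_distrib, deg]
    push_cast
    simp
    ring
  linarith

lemma sum_sum_sq_shiftedCount_step_sub_le (d : ℕ) :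
    ∑ u, ∑ v, (shiftedCount (step G u v) (d + 1) - shiftedCount G (d + 1)) ^ 2
      ≤ m * (6 * degSum G (fun k => (k : ℝ) ^ 2) + 27 * m) := by
  have h : ∀ u v, (shiftedCount (step G u v) (d + 1) - shiftedCount G (d + 1)) ^ 2
      ≤ 3 * (deg G u : ℝ) ^ 2 + 3 * (deg G v : ℝ) ^ 2 + 27 := by
    intro u v
    have := sq_le_sq' (abs_le.1 (abs_shiftedCount_step_sub_le G u v d)).1
      (abs_le.1 (abs_shiftedCount_step_sub_le G u v d)).2
    nlinarith [sq_nonneg ((deg G u : ℝ) - deg G v), sq_nonneg ((deg G u : ℝ) - 3),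
      sq_nonneg ((deg G v : ℝ) - 3)]
  refine (Finset.sum_le_sum fun u _ => Finset.sum_le_sum fun v _ => h u v).trans ?_
  simp only [Finset.sum_add_distrib, ← Finset.mul_sum, degSum]
  simp [← Finset.mul_sum]
  linarith

lemma sum_degSum_step_id :
    ∑ u, ∑ v, degSum (step G u v) (fun k => (k : ℝ))
      = m ^ 2 * (degSum G (fun k => (k : ℝ)) + 2) := by
  rw [sum_degSum_step]
  simp only [contribution_id, Finset.sum_add_distrib, ← Finset.mul_sum, degSum]
  simp
  ring

lemma sum_degSum_step_sq_le :
    ∑ u, ∑ v, degSum (step G u v) (fun k => (k : ℝ) ^ 2)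
      ≤ m ^ 2 * degSum G (fun k => (k : ℝ) ^ 2)
        + m * (6 * degSum G (fun k => (k : ℝ)) + 3 * m) := by
  rw [sum_degSum_step]
  refine (Finset.sum_le_sum fun x _ => contribution_sq_le m _ (deg_lt G x)).trans ?_
  simp only [Finset.sum_add_distrib, ← Finset.mul_sum, degSum]
  simp
  linarith

lemma sq_degSum_le :
    degSum G (fun k => (k : ℝ)) ^ 2 ≤ m * degSum G (fun k => (k : ℝ) ^ 2) := by
  simpa [degSum] using sq_sum_le_card_mul_sum_sq (s := Finset.univ) (f := fun x => (deg G x : ℝ))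

end Step

/-! ### The stationary equation -/

/-- Monotone approximations, from below, of the limiting degree distribution, with the index shifted
by one and the boundary value `1` at index `0`. -/
noncomputable def approx : ℕ → ℕ → ℝ
  | 0, _ => 0
  | _ + 1, 0 => 1
  | k + 1, d + 1 => ((d : ℝ) + 1) / (2 * d + 3) * (approx k d + approx k (d + 2))

lemma approx_mem_Icc (k j : ℕ) : approx k j ∈ Set.Icc (0 : ℝ) 1 := by
  induction k generalizing j with
  | zero => simp [approx]
  | succ k ih =>
    rcases j with _ | d
    · simp [approx]
    · have h1 := ih d
      have h2 := ih (d + 2)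
      refine ⟨mul_nonneg (by positivity) (add_nonneg h1.1 h2.1), ?_⟩
      rw [approx, div_mul_eq_mul_div, div_le_one (by positivity)]
      have := mul_le_mul_of_nonneg_left (add_le_add h1.2 h2.2) (by positivity : (0 : ℝ) ≤ d + 1)
      linarith

lemma approx_le_succ (k j : ℕ) : approx k j ≤ approx (k + 1) j := by
  induction k generalizing j with
  | zero => simpa [approx] using (approx_mem_Icc 1 j).1
  | succ k ih =>
    rcases j with _ | d
    · simp [approx]
    · rw [approx, approx]
      exact mul_le_mul_of_nonneg_left (add_le_add (ih d) (ih (d + 2))) (by positivity)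

lemma exists_stationary : ∃ s : ℕ → ℝ, s 0 = 1 ∧ (∀ j, s j ∈ Set.Icc (0 : ℝ) 1) ∧
    ∀ d : ℕ, s (d + 1) = ((d : ℝ) + 1) / (2 * d + 3) * (s d + s (d + 2)) := by
  have hlim : ∀ j, ∃ l, Tendsto (fun k => approx k j) atTop (𝓝 l) := fun j =>
    ⟨_, tendsto_atTop_ciSup (monotone_nat_of_le_succ fun k => approx_le_succ k j)
      ⟨1, by rintro _ ⟨k, rfl⟩; exact (approx_mem_Icc k j).2⟩⟩
  choose s hs using hlim
  refine ⟨s, ?_, fun j => ?_, fun d => ?_⟩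
  · refine tendsto_nhds_unique ((tendsto_add_atTop_iff_nat 1).2 (hs 0)) ?_
    simp [approx]
  · exact isClosed_Icc.mem_of_tendsto (hs j) (Eventually.of_forall fun k => approx_mem_Icc k j)
  · refine tendsto_nhds_unique ((tendsto_add_atTop_iff_nat 1).2 (hs (d + 1))) ?_
    simp only [approx]
    exact ((hs d).add (hs (d + 2))).const_mul _

/-- A bounded nonnegative subsolution of the homogeneous recursion vanishes: it is convex. -/
lemma eq_zero_of_subsolution {z : ℕ → ℝ} {B : ℝ} (h0 : z 0 = 0) (hz : ∀ j, 0 ≤ z j)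
    (hB : ∀ j, z j ≤ B)
    (h : ∀ d : ℕ, (2 * (d : ℝ) + 3) * z (d + 1) ≤ (d + 1) * (z d + z (d + 2))) (j : ℕ) :
    z j = 0 := by
  -- Split `2 d + 3 = 2 (d + 1) + 1` and drop the nonnegative extra `z (d + 1)`.
  have hconv : ∀ d, z (d + 1) - z d ≤ z (d + 2) - z (d + 1) := by
    intro d
    have h1 := h d
    have h2 := hz (d + 1)
    have h3 : (0 : ℝ) < d + 1 := by positivity
    refine le_of_mul_le_mul_left ?_ h3
    linarith
  have hmono : Monotone fun d => z (d + 1) - z d := monotone_nat_of_le_succ hconv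
  -- By convexity a positive increment would persist and force linear growth beyond `B`.
  have hle : ∀ d, z (d + 1) - z d ≤ 0 := by
    intro d
    by_contra hpos
    push Not at hpos
    have hgrow : ∀ n : ℕ, n * (z (d + 1) - z d) ≤ z (d + n) := by
      intro n
      induction n with
      | zero => simpa using hz d
      | succ n ih =>
        have := hmono (Nat.le_add_right d n)
        simp only at this
        push_cast
        rw [← add_assoc]
        linarith
    obtain ⟨n, hn⟩ := exists_nat_gt (B / (z (d + 1) - z d))
    rw [div_lt_iff₀ hpos] at hn
    linarith [hgrow n, hB (d + n)]
  induction j with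
  | zero => exact h0
  | succ j ih => linarith [hle j, hz (j + 1)]

/-! ### Deterministic analysis of the perturbed recursion -/

/-- The line `β / (1 + α) * (n + 1)` solves the recursion with equality. Once `n ≥ α` the factor is
nonnegative and at most `1`, so an excess `C` over this line never grows. -/
lemma exists_eventually_le_of_recursion {R : ℕ → ℝ} {α β : ℝ} (hα : 0 ≤ α)
    (h : ∀ᶠ n : ℕ in atTop, R (n + 1) ≤ (1 - α / (n + 1)) * R n + β) :
    ∃ C, ∀ᶠ n : ℕ in atTop, R n ≤ β / (1 + α) * (n + 1) + C := by
  obtain ⟨n₁, hn₁⟩ := eventually_atTop.1 h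
  obtain ⟨n₂, hn₂⟩ := exists_nat_ge α
  set n₀ := max n₁ n₂
  set γ := β / (1 + α) with hγ
  have hβ : β = γ * (1 + α) := by rw [hγ]; field_simp
  refine ⟨max 0 (R n₀ - γ * (n₀ + 1)), eventually_atTop.2 ⟨n₀, fun n hn => ?_⟩⟩
  induction n, hn using Nat.le_induction with
  | base => linarith [le_max_right 0 (R n₀ - γ * (n₀ + 1))]
  | succ n hn ih =>
    have hC := le_max_left 0 (R n₀ - γ * (n₀ + 1))
    generalize max 0 (R n₀ - γ * (n₀ + 1)) = C at *
    have h1 := hn₁ n ((le_max_left _ _).trans hn)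
    have h2 : α ≤ n := hn₂.trans (by exact_mod_cast (le_max_right n₁ n₂).trans hn)
    have h3 : (0 : ℝ) < n + 1 := by positivity
    have h4 : 0 ≤ 1 - α / (n + 1) := by
      rw [sub_nonneg, div_le_one h3]; linarith
    have h5 := mul_le_mul_of_nonneg_left ih h4
    have h6 : (1 - α / (n + 1)) * (γ * (n + 1) + C) + β = γ * (n + 2) + C - α / (n + 1) * C := by
      rw [hβ]; field_simp; ring
    have h7 : 0 ≤ α / (n + 1) * C := by positivity
    push_cast
    linarith

/-- Passing to `δ - M` removes the increments of `M`, which need not be small; only the ratio `M n /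
(n + 1)` remains, and it tends to zero. -/
lemma eventually_abs_le_of_recursion {δ M b : ℕ → ℝ} {α β γ : ℝ} (hα : 0 ≤ α)
    (h : ∀ n : ℕ, δ (n + 1) = δ n - α * (δ n / (n + 1)) + b n + (M (n + 1) - M n))
    (hM : Tendsto (fun n : ℕ => M n / (n + 1)) atTop (𝓝 0))
    (hb : ∀ β' > β, ∀ᶠ n in atTop, |b n| ≤ β') (hγ : β < γ * (1 + α)) :
    ∀ᶠ n : ℕ in atTop, |δ n / (n + 1)| ≤ γ := by
  have hα1 : 0 < 1 + α := by linarith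
  -- Of the slack `3 * η`, one `η` covers `b`, one the term `α * M n / (n + 1)`, and the last is
  -- halved between the additive constant and the return from `δ - M` to `δ`.
  obtain ⟨η, hη, hη'⟩ : ∃ η > 0, γ = (β + 3 * η) / (1 + α) :=
    ⟨(γ * (1 + α) - β) / 3, by linarith, by field_simp; ring⟩
  have hMsmall : ∀ ε > 0, ∀ᶠ n : ℕ in atTop, |M n / (n + 1)| ≤ ε := fun ε hε => by
    filter_upwards [Metric.tendsto_nhds.1 hM ε hε] with n hn
    simpa only [Real.dist_eq, sub_zero] using hn.le
  have main : ∀ σ : ℝ, |σ| = 1 → ∃ C, ∀ᶠ n : ℕ in atTop,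
      σ * (δ n - M n) ≤ (β + 2 * η) / (1 + α) * (n + 1) + C := by
    intro σ hσ
    refine exists_eventually_le_of_recursion hα ?_
    filter_upwards [hb (β + η) (by linarith), hMsmall (η / (1 + α)) (by positivity)]
      with n h1 h2
    have h3 : σ * (δ (n + 1) - M (n + 1)) = (1 - α / (n + 1)) * (σ * (δ n - M n))
        + (σ * b n + α * -(σ * (M n / (n + 1)))) := by
      rw [h n]; ring
    have h4 : σ * b n ≤ β + η := (le_abs_self _).trans (by rwa [abs_mul, hσ, one_mul])
    have h5 : -(σ * (M n / (n + 1))) ≤ η / (1 + α) :=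
      (neg_le_abs _).trans (by rwa [abs_mul, hσ, one_mul])
    have h6 := mul_le_mul_of_nonneg_left h5 hα
    have h7 : α * (η / (1 + α)) ≤ η := by
      rw [mul_div_assoc', div_le_iff₀ hα1]; nlinarith
    linarith
  obtain ⟨C₁, h₁⟩ := main 1 (by simp)
  obtain ⟨C₂, h₂⟩ := main (-1) (by simp)
  have hC : ∀ᶠ n : ℕ in atTop, max C₁ C₂ ≤ η / (2 * (1 + α)) * n :=
    (tendsto_natCast_atTop_atTop.const_mul_atTop
      (by positivity : 0 < η / (2 * (1 + α)))).eventually_ge_atTop _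
  filter_upwards [h₁, h₂, hC, hMsmall (η / (2 * (1 + α))) (by positivity)] with n h₁ h₂ hC hMn
  have hn : (0 : ℝ) < n + 1 := by positivity
  rw [abs_div, abs_of_pos hn, div_le_iff₀ hn] at hMn ⊢
  have h3 := abs_le.1 hMn
  have e : γ * (n + 1) = (β + 2 * η) / (1 + α) * (n + 1) + η / (2 * (1 + α)) * (n + 1)
      + η / (2 * (1 + α)) * (n + 1) := by
    rw [hη']; field_simp; ring
  have h4 : 0 < η / (2 * (1 + α)) := by positivity
  have := le_max_left C₁ C₂
  have := le_max_right C₁ C₂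
  rw [abs_le]
  constructor <;> linarith

/-- Sequences that follow the recursion of the degree counts, up to a perturbation of sublinear
sum, have the stationary proportions as limits. -/
lemma tendsto_of_perturbed_recursion {x e M : ℕ → ℕ → ℝ} {s : ℕ → ℝ} (hs0 : s 0 = 1)
    (hs : ∀ j, s j ∈ Set.Icc (0 : ℝ) 1)
    (hrec : ∀ d : ℕ, s (d + 1) = ((d : ℝ) + 1) / (2 * d + 3) * (s d + s (d + 2)))
    (hx0 : ∀ n, x 0 n = n + 1) (hxnn : ∀ j n, 0 ≤ x j n) (hxle : ∀ j n, x j n ≤ n + 1)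
    (he : ∀ d, Tendsto (e d) atTop (𝓝 0))
    (hM : ∀ d, Tendsto (fun n : ℕ => M d n / (n + 1)) atTop (𝓝 0))
    (h : ∀ d n : ℕ, x (d + 1) (n + 1) = x (d + 1) n
      + (d + 1) * (x d n + x (d + 2) n - 2 * x (d + 1) n) / (n + 1) + e d n
      + (M d (n + 1) - M d n)) (j : ℕ) :
    Tendsto (fun n : ℕ => x j n / (n + 1)) atTop (𝓝 (s j)) := by
  set y : ℕ → ℕ → ℝ := fun j n => |x j n / (n + 1) - s j| with hy
  have hy1 : ∀ j n, y j n ≤ 1 := by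
    intro j n
    have hn : (0 : ℝ) < n + 1 := by positivity
    have h1 : 0 ≤ x j n / (n + 1) := div_nonneg (hxnn j n) hn.le
    have h2 : x j n / (n + 1) ≤ 1 := (div_le_one hn).2 (hxle j n)
    have h3 := hs j
    exact abs_le.2 ⟨by linarith [h3.2], by linarith [h3.1]⟩
  have hbdd : ∀ j, IsBoundedUnder (· ≤ ·) atTop (y j) := fun j =>
    isBoundedUnder_of ⟨1, hy1 j⟩
  have hcobdd : ∀ j, IsCoboundedUnder (· ≤ ·) atTop (y j) := fun j =>
    (isBoundedUnder_of ⟨0, fun n => abs_nonneg _⟩ :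
      IsBoundedUnder (· ≥ ·) atTop (y j)).isCoboundedUnder_le
  set z : ℕ → ℝ := fun j => limsup (y j) atTop with hz
  have hlt : ∀ j, ∀ a > z j, ∀ᶠ n in atTop, y j n < a := fun j a ha =>
    eventually_lt_of_limsup_lt ha (hbdd j)
  have hznn : ∀ j, 0 ≤ z j := fun j =>
    le_limsup_of_frequently_le (Frequently.of_forall fun n => abs_nonneg _) (hbdd j)
  have hz1 : ∀ j, z j ≤ 1 := fun j =>
    limsup_le_of_le (hcobdd j) (Eventually.of_forall (hy1 j))
  have hz0 : z 0 = 0 := by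
    have : y 0 = fun _ => 0 := by
      funext n
      have hn : (n : ℝ) + 1 ≠ 0 := by positivity
      simp [hy, hx0, hs0, hn]
    simp [hz, this]
  have hsub : ∀ d : ℕ, (2 * (d : ℝ) + 3) * z (d + 1) ≤ (d + 1) * (z d + z (d + 2)) := by
    intro d
    have hd : (0 : ℝ) < 2 * d + 3 := by positivity
    rw [mul_comm, ← le_div_iff₀ hd]
    refine le_of_forall_gt_imp_ge_of_dense fun γ hγ => ?_
    refine limsup_le_of_le (hcobdd _) ?_
    -- Stationarity of `s` cancels the constant terms. The damping `α = 2 (d + 1)` comes from the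
    -- second difference, and `1 + α = 2 d + 3` is the coefficient wanted.
    have := eventually_abs_le_of_recursion (δ := fun n => x (d + 1) n - s (d + 1) * (n + 1))
      (M := M d) (α := 2 * (d + 1)) (β := (d + 1) * (z d + z (d + 2))) (γ := γ)
      (b := fun n => (d + 1) * ((x d n / (n + 1) - s d) + (x (d + 2) n / (n + 1) - s (d + 2)))
        + e d n) (by positivity) ?_ (hM d) ?_ ?_
    · filter_upwards [this] with n hn
      have hn0 : (n : ℝ) + 1 ≠ 0 := by positivity
      rwa [sub_div, mul_div_cancel_right₀ _ hn0] at hn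
    · intro n
      have hn0 : (n : ℝ) + 1 ≠ 0 := by positivity
      have hr : s (d + 1) * (2 * d + 3) = (d + 1) * (s d + s (d + 2)) := by
        rw [hrec d]; field_simp
      simp only [h d n]
      push_cast
      field_simp
      linear_combination (-(n : ℝ) - 1) * hr
    · intro β' hβ'
      obtain ⟨η, hη, hη'⟩ : ∃ η > 0, β' = (d + 1) * ((z d + η) + (z (d + 2) + η)) + η :=
        ⟨(β' - (d + 1) * (z d + z (d + 2))) / (2 * (d + 1) + 1), by
          apply div_pos <;> [linarith; positivity], by field_simp; ring⟩
      filter_upwards [hlt d (z d + η) (by linarith), hlt (d + 2) (z (d + 2) + η) (by linarith),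
        Metric.tendsto_nhds.1 (he d) η hη] with n h1 h2 h3
      rw [Real.dist_eq, sub_zero] at h3
      rw [hη']
      refine (abs_add_le _ _).trans (add_le_add ?_ h3.le)
      rw [abs_mul, abs_of_pos (by positivity : (0 : ℝ) < d + 1)]
      gcongr
      exact (abs_add_le _ _).trans (add_le_add h1.le h2.le)
    · rw [div_lt_iff₀ hd] at hγ
      linarith
  have hzero := eq_zero_of_subsolution hz0 hznn hz1 hsub j
  rw [Metric.tendsto_nhds]
  intro ε hε
  filter_upwards [hlt j ε (by rw [hzero]; exact hε)] with n hn
  rwa [Real.dist_eq]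

/-! ### A strong law for orthogonal increments -/

section LargeNumbers

variable {Ω : Type*} [MeasurableSpace Ω] {μ : Measure Ω}

/-- The sum of all `Z k` has finite integral, so it is finite almost everywhere and its terms tend
to zero. -/
lemma ae_tendsto_zero_of_summable_integral {Z : ℕ → Ω → ℝ} (hnn : ∀ k ω, 0 ≤ Z k ω)
    (hint : ∀ k, Integrable (Z k) μ) (hsum : Summable fun k => ∫ ω, Z k ω ∂μ) :
    ∀ᵐ ω ∂μ, Tendsto (fun k => Z k ω) atTop (𝓝 0) := by
  have hmeas : ∀ k, AEMeasurable (fun ω => ENNReal.ofReal (Z k ω)) μ := fun k =>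
    (hint k).aemeasurable.ennreal_ofReal
  have hfin : ∫⁻ ω, ∑' k, ENNReal.ofReal (Z k ω) ∂μ ≠ ⊤ := by
    rw [lintegral_tsum hmeas]
    have : ∀ k, ∫⁻ ω, ENNReal.ofReal (Z k ω) ∂μ = ENNReal.ofReal (∫ ω, Z k ω ∂μ) := fun k =>
      (ofReal_integral_eq_lintegral_ofReal (hint k) (Eventually.of_forall (hnn k))).symm
    simp only [this]
    exact hsum.tsum_ofReal_ne_top
  filter_upwards [ae_lt_top' (AEMeasurable.tsum hmeas) hfin] with ω hω
  have h := (ENNReal.tendsto_toReal (by simp)).comp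
    (ENNReal.tendsto_atTop_zero_of_tsum_ne_top hω.ne)
  simpa [Function.comp_def, ENNReal.toReal_ofReal (hnn _ ω)] using h

lemma summable_const_div_add_one_sq (C : ℝ) : Summable fun k : ℕ => C / ((k : ℝ) + 1) ^ 2 := by
  have h := (summable_nat_add_iff 1).2 (Real.summable_one_div_nat_pow.2 one_lt_two)
  simpa [div_eq_mul_inv] using h.mul_left C

/-- A strong law of large numbers for increments with bounded second moments that are orthogonal to
the sums of the preceding ones. -/
lemma ae_tendsto_sum_div_of_orthogonal {D : ℕ → Ω → ℝ} {C : ℝ} (hD : ∀ n, MemLp (D n) 2 μ)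
    (hC : ∀ n, ∫ ω, D n ω ^ 2 ∂μ ≤ C)
    (horth : ∀ n, ∫ ω, (∑ k ∈ Finset.range n, D k ω) * D n ω ∂μ = 0) :
    ∀ᵐ ω ∂μ, Tendsto (fun n : ℕ => (∑ k ∈ Finset.range n, D k ω) / ((n : ℝ) + 1)) atTop
      (𝓝 0) := by
  set S : ℕ → Ω → ℝ := fun n ω => ∑ k ∈ Finset.range n, D k ω with hS
  have hSL : ∀ n, MemLp (S n) 2 μ := fun n => memLp_finsetSum _ fun k _ => hD k
  have hSC : ∀ n : ℕ, ∫ ω, S n ω ^ 2 ∂μ ≤ n * C := by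
    intro n
    induction n with
    | zero => simp [hS]
    | succ n ih =>
      have e : ∀ ω, S (n + 1) ω ^ 2 = S n ω ^ 2 + D n ω ^ 2 + 2 * (S n ω * D n ω) := by
        intro ω; simp only [hS, Finset.sum_range_succ]; ring
      simp only [e]
      have i1 : Integrable (fun ω => S n ω * D n ω) μ := (hSL n).integrable_mul (hD n)
      have i2 : Integrable (fun ω => S n ω ^ 2 + D n ω ^ 2) μ :=
        (hSL n).integrable_sq.add (hD n).integrable_sq
      rw [integral_add i2 (i1.const_mul 2),
        integral_add (hSL n).integrable_sq (hD n).integrable_sq, integral_const_mul, horth n]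
      push_cast
      linarith [hC n]
  -- Along the squares the bound `n * C` on second moments becomes summable after normalisation.
  -- Between consecutive squares Cauchy–Schwarz costs the block length `2 k + 1`, which is still
  -- affordable.
  set J : ℕ → Finset ℕ := fun k => Finset.Ico (k ^ 2) ((k + 1) ^ 2) with hJ
  have hJcard : ∀ k, ((J k).card : ℝ) = 2 * k + 1 := by
    intro k
    have : (J k).card = 2 * k + 1 := by
      rw [hJ, Nat.card_Ico]; exact Nat.sub_eq_of_eq_add (by ring)
    rw [this]; push_cast; ring
  set Z : ℕ → Ω → ℝ := fun (k : ℕ) ω =>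
    (S (k ^ 2) ω ^ 2 + (2 * (k : ℝ) + 1) * ∑ i ∈ J k, D i ω ^ 2) / ((k : ℝ) + 1) ^ 4 with hZ
  have hblock : ∀ k : ℕ, Integrable (fun ω => (2 * (k : ℝ) + 1) * ∑ i ∈ J k, D i ω ^ 2) μ := fun k =>
    (integrable_finsetSum _ fun i _ => (hD i).integrable_sq).const_mul _
  have hZint : ∀ k, Integrable (Z k) μ := fun k =>
    ((hSL (k ^ 2)).integrable_sq.add (hblock k)).div_const _
  have hZnn : ∀ k ω, 0 ≤ Z k ω := fun k ω => by positivity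
  have hC0 : 0 ≤ C := (integral_nonneg fun ω => sq_nonneg (D 0 ω)).trans (hC 0)
  have hZE : ∀ k : ℕ, ∫ ω, Z k ω ∂μ ≤ 5 * C / ((k : ℝ) + 1) ^ 2 := by
    intro k
    have h1 : ∫ ω, S (k ^ 2) ω ^ 2 ∂μ ≤ k ^ 2 * C := by exact_mod_cast hSC (k ^ 2)
    have h2 : ∑ i ∈ J k, ∫ ω, D i ω ^ 2 ∂μ ≤ (2 * k + 1) * C := by
      refine (Finset.sum_le_sum fun i _ => hC i).trans ?_
      rw [Finset.sum_const, nsmul_eq_mul, hJcard]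
    simp only [hZ]
    rw [integral_div, integral_add (hSL (k ^ 2)).integrable_sq (hblock k), integral_const_mul,
      integral_finsetSum _ fun i _ => (hD i).integrable_sq,
      div_le_div_iff₀ (by positivity) (by positivity)]
    have h3 := mul_le_mul_of_nonneg_left h2 (by positivity : (0 : ℝ) ≤ 2 * k + 1)
    have h4 : (k : ℝ) ^ 2 * C + (2 * k + 1) * ((2 * k + 1) * C) ≤ 5 * C * ((k : ℝ) + 1) ^ 2 := by
      have : 0 ≤ C * (6 * (k : ℝ) + 4) := by positivity
      linarith
    calc _ ≤ (5 * C * ((k : ℝ) + 1) ^ 2) * ((k : ℝ) + 1) ^ 2 := by gcongr; linarith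
      _ = _ := by ring
  have hZsum : Summable fun k => ∫ ω, Z k ω ∂μ :=
    Summable.of_nonneg_of_le (fun k => integral_nonneg (hZnn k)) hZE
      (summable_const_div_add_one_sq _)
  filter_upwards [ae_tendsto_zero_of_summable_integral hZnn hZint hZsum] with ω hω
  have hsqrt : Tendsto Nat.sqrt atTop atTop :=
    tendsto_atTop_mono' _ (f₁ := fun n => Nat.sqrt n) (Eventually.of_forall fun n => le_rfl)
      (tendsto_atTop.2 fun b => eventually_atTop.2 ⟨b * b, fun n hn => Nat.le_sqrt.2 hn⟩)
  -- The `8` is `2` from `(a + b) ^ 2 ≤ 2 (a ^ 2 + b ^ 2)` times `4` from `(k + 1) ^ 4 ≤ 4 (n + 1) ^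
  -- 2`.
  have hlim : Tendsto (fun n : ℕ => 8 * Z (Nat.sqrt n) ω) atTop (𝓝 0) := by
    simpa using (hω.comp hsqrt).const_mul 8
  have hsq : Tendsto (fun n : ℕ => (S n ω / ((n : ℝ) + 1)) ^ 2) atTop (𝓝 0) := by
    refine squeeze_zero (fun n => sq_nonneg _) (fun n => ?_) hlim
    set k := Nat.sqrt n with hk
    have hk1 : k ^ 2 ≤ n := Nat.sqrt_le' n
    have hk2 : n < (k + 1) ^ 2 := Nat.lt_succ_sqrt' n
    have hsplit : S n ω = S (k ^ 2) ω + ∑ i ∈ Finset.Ico (k ^ 2) n, D i ω :=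
      (Finset.sum_range_add_sum_Ico _ hk1).symm
    have hcs : (∑ i ∈ Finset.Ico (k ^ 2) n, D i ω) ^ 2 ≤ (2 * k + 1) * ∑ i ∈ J k, D i ω ^ 2 := by
      have hsubset : Finset.Ico (k ^ 2) n ⊆ J k := Finset.Ico_subset_Ico_right hk2.le
      calc (∑ i ∈ Finset.Ico (k ^ 2) n, D i ω) ^ 2
          ≤ (Finset.Ico (k ^ 2) n).card * ∑ i ∈ Finset.Ico (k ^ 2) n, D i ω ^ 2 :=
            sq_sum_le_card_mul_sum_sq
        _ ≤ (J k).card * ∑ i ∈ J k, D i ω ^ 2 := by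
            gcongr
        _ = _ := by rw [hJcard]
    have hn : ((k : ℝ) + 1) ^ 2 ≤ 2 * (n + 1) := by
      have : (k : ℝ) ^ 2 ≤ n := by exact_mod_cast hk1
      nlinarith [sq_nonneg ((k : ℝ) - 1)]
    have hn4 : ((k : ℝ) + 1) ^ 4 ≤ 4 * ((n : ℝ) + 1) ^ 2 := by
      calc ((k : ℝ) + 1) ^ 4 = (((k : ℝ) + 1) ^ 2) ^ 2 := by ring
        _ ≤ (2 * ((n : ℝ) + 1)) ^ 2 := by gcongr
        _ = _ := by ring
    set W := S (k ^ 2) ω ^ 2 + (2 * (k : ℝ) + 1) * ∑ i ∈ J k, D i ω ^ 2 with hW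
    have hWnn : 0 ≤ W := by positivity
    have hSW : S n ω ^ 2 ≤ 2 * W := by
      rw [hsplit]
      nlinarith [sq_nonneg (S (k ^ 2) ω - ∑ i ∈ Finset.Ico (k ^ 2) n, D i ω)]
    have : Z k ω = W / ((k : ℝ) + 1) ^ 4 := rfl
    rw [this, div_pow, mul_div_assoc', div_le_div_iff₀ (by positivity) (by positivity)]
    calc S n ω ^ 2 * ((k : ℝ) + 1) ^ 4 ≤ (2 * W) * (4 * ((n : ℝ) + 1) ^ 2) := by gcongr
      _ = _ := by ring
  have := hsq.sqrt
  simp only [Real.sqrt_sq_eq_abs, Real.sqrt_zero] at this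
  exact (tendsto_zero_iff_abs_tendsto_zero _).2 this

end LargeNumbers

/-! ### Dependence on the past and averaging over the next step -/

section RandomChoice

variable {Ω : Type*} {U V : (n : ℕ) → Ω → Fin (n + 1)}

/-- `Y` is a function of the choices of the first `n` steps. -/
def DependsOnPast {β : Type*} (U V : (n : ℕ) → Ω → Fin (n + 1)) (n : ℕ) (Y : Ω → β) : Prop :=
  ∀ ω ω', (∀ k < n, U k ω = U k ω' ∧ V k ω = V k ω') → Y ω = Y ω'

lemma DependsOnPast.mono {β : Type*} {n m : ℕ} {Y : Ω → β} (h : DependsOnPast U V n Y)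
    (hnm : n ≤ m) : DependsOnPast U V m Y :=
  fun ω ω' hω => h ω ω' fun k hk => hω k (hk.trans_le hnm)

lemma DependsOnPast.comp {β γ : Type*} {n : ℕ} {Y : Ω → β} (h : DependsOnPast U V n Y)
    (g : β → γ) : DependsOnPast U V n fun ω => g (Y ω) :=
  fun ω ω' hω => congrArg g (h ω ω' hω)

lemma DependsOnPast.comp₂ {β γ δ : Type*} {n : ℕ} {Y : Ω → β} {Z : Ω → γ}
    (hY : DependsOnPast U V n Y) (hZ : DependsOnPast U V n Z) (g : β → γ → δ) :
    DependsOnPast U V n fun ω => g (Y ω) (Z ω) :=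
  fun ω ω' hω => congrArg₂ g (hY ω ω' hω) (hZ ω ω' hω)

lemma DependsOnPast.sum {n : ℕ} {ι : Type*} {s : Finset ι} {Y : ι → Ω → ℝ}
    (h : ∀ i ∈ s, DependsOnPast U V n (Y i)) : DependsOnPast U V n fun ω => ∑ i ∈ s, Y i ω :=
  fun ω ω' hω => Finset.sum_congr rfl fun i hi => h i hi ω ω' hω

lemma DependsOnPast.step {β : Type*} {n : ℕ} {f : Ω → Fin (n + 1) → Fin (n + 1) → β}
    (h : DependsOnPast U V n f) : DependsOnPast U V (n + 1) fun ω => f ω (U n ω) (V n ω) := by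
  intro ω ω' hω
  have h1 := h ω ω' fun k hk => hω k (hk.trans n.lt_succ_self)
  have h2 := hω n n.lt_succ_self
  simp only [h1, h2.1, h2.2]

/-- The choices of the first `n` steps. -/
def past (U V : (n : ℕ) → Ω → Fin (n + 1)) (n : ℕ) (ω : Ω) :
    (i : Finset.range n) → Fin (i + 1) × Fin (i + 1) :=
  fun i => (U i ω, V i ω)

/-- The history takes finitely many values, so this factorisation yields measurability, boundedness
and independence from the next step without a filtration or conditional expectations. -/
lemma DependsOnPast.exists_eq_comp {n : ℕ} {Y : Ω → ℝ} (h : DependsOnPast U V n Y) :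
    ∃ φ : ((i : Finset.range n) → Fin (i + 1) × Fin (i + 1)) → ℝ, Y = φ ∘ past U V n := by
  refine (Function.factorsThrough_iff Y).1 fun ω ω' hω => h ω ω' fun k hk => ?_
  have := congrFun hω ⟨k, Finset.mem_range.2 hk⟩
  exact ⟨congrArg Prod.fst this, congrArg Prod.snd this⟩

variable [MeasurableSpace Ω] {μ : Measure Ω}

namespace IsRandomChoice

lemma measurable_past (h : IsRandomChoice μ U V) (n : ℕ) : Measurable (past U V n) :=
  measurable_pi_iff.2 fun i => (h.measurable_fst i).prodMk (h.measurable_snd i)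

lemma measurable (h : IsRandomChoice μ U V) {n : ℕ} {Y : Ω → ℝ} (hY : DependsOnPast U V n Y) :
    Measurable Y := by
  obtain ⟨φ, rfl⟩ := hY.exists_eq_comp
  exact (measurable_of_countable φ).comp (h.measurable_past n)

lemma measureReal_pair (h : IsRandomChoice μ U V) (n : ℕ) (a b : Fin (n + 1)) :
    μ.real ((fun ω => (U n ω, V n ω)) ⁻¹' {(a, b)}) = (((n : ℝ) + 1) ^ 2)⁻¹ := by
  have h1 : (fun ω => (U n ω, V n ω)) ⁻¹' {(a, b)} = U n ⁻¹' {a} ∩ V n ⁻¹' {b} := by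
    ext ω; simp
  rw [h1, measureReal_def, (h.indep_within_step n).measure_inter_preimage_eq_mul _ _
    (measurableSet_singleton a) (measurableSet_singleton b), h.uniform_fst, h.uniform_snd,
    ENNReal.toReal_mul, ENNReal.toReal_inv,
    ENNReal.toReal_add (ENNReal.natCast_ne_top n) ENNReal.one_ne_top]
  simp [sq]

lemma indepFun_past (h : IsRandomChoice μ U V) (n : ℕ) :
    IndepFun (past U V n) (fun ω => (U n ω, V n ω)) μ := by
  have h1 := h.indep_steps.indepFun_finset (Finset.range n) {n} (by simp)
    fun i => (h.measurable_fst i).prodMk (h.measurable_snd i)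
  have h2 := h1.comp measurable_id (measurable_pi_apply (⟨n, by simp⟩ : ({n} : Finset ℕ)))
  exact h2

variable [IsProbabilityMeasure μ]

lemma memLp (h : IsRandomChoice μ U V) {n : ℕ} {Y : Ω → ℝ} (hY : DependsOnPast U V n Y)
    (p : ENNReal) : MemLp Y p μ := by
  have hm := h.measurable hY
  obtain ⟨φ, rfl⟩ := hY.exists_eq_comp
  obtain ⟨B, hB⟩ := (Set.finite_range fun a => ‖φ a‖).bddAbove
  exact MemLp.of_bound hm.aestronglyMeasurable B (Eventually.of_forall fun ω => hB ⟨_, rfl⟩)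

lemma integrable (h : IsRandomChoice μ U V) {n : ℕ} {Y : Ω → ℝ} (hY : DependsOnPast U V n Y) :
    Integrable Y μ :=
  memLp_one_iff_integrable.1 (h.memLp hY 1)

/-- Averaging over the choices of the next step. -/
lemma integral_step (h : IsRandomChoice μ U V) {n : ℕ} {f : Ω → Fin (n + 1) → Fin (n + 1) → ℝ}
    (hf : DependsOnPast U V n f) :
    ∫ ω, f ω (U n ω) (V n ω) ∂μ = ∫ ω, (((n : ℝ) + 1) ^ 2)⁻¹ * ∑ u, ∑ v, f ω u v ∂μ := by
  classical
  set A : Ω → Fin (n + 1) × Fin (n + 1) := fun ω => (U n ω, V n ω) with hA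
  have hAm : Measurable A := (h.measurable_fst n).prodMk (h.measurable_snd n)
  have hfuv : ∀ u v, DependsOnPast U V n fun ω => f ω u v := fun u v => hf.comp fun g => g u v
  set ψ : Fin (n + 1) → Fin (n + 1) → Fin (n + 1) × Fin (n + 1) → ℝ :=
    fun u v a => if a = (u, v) then 1 else 0 with hψ
  have hψi : ∀ u v, Integrable (fun ω => f ω u v * ψ u v (A ω)) μ := by
    intro u v
    have hd : DependsOnPast U V (n + 1) fun ω => f ω u v * ψ u v (A ω) :=
      ((hfuv u v).mono n.le_succ).comp₂ (Y := fun ω => f ω u v)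
        (DependsOnPast.step (f := fun _ a b => ψ u v (a, b)) fun _ _ _ => rfl) (· * ·)
    exact h.integrable hd
  -- Splitting by the value of the choice gives products of a function of the past and an
  -- independent indicator.
  have e : ∀ ω, f ω (U n ω) (V n ω) = ∑ u, ∑ v, f ω u v * ψ u v (A ω) := by
    intro ω
    rw [Finset.sum_eq_single (U n ω), Finset.sum_eq_single (V n ω)]
    · simp [hψ, hA]
    · intro v _ hv; simp [hψ, hA, hv.symm]
    · simp
    · intro u _ hu; simp [hψ, hA, hu.symm]
    · simp
  have key : ∀ u v, ∫ ω, f ω u v * ψ u v (A ω) ∂μ = (((n : ℝ) + 1) ^ 2)⁻¹ * ∫ ω, f ω u v ∂μ := by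
    intro u v
    have hind : IndepFun (fun ω => f ω u v) (fun ω => ψ u v (A ω)) μ := by
      obtain ⟨φ, hφ⟩ := (hfuv u v).exists_eq_comp
      rw [hφ]
      exact (h.indepFun_past n).comp (measurable_of_countable φ) (measurable_of_countable (ψ u v))
    have h1 := hind.integral_mul_eq_mul_integral
      (h.measurable (hfuv u v)).aestronglyMeasurable
      ((measurable_of_countable (ψ u v)).comp hAm).aestronglyMeasurable
    have h2 : ∫ ω, ψ u v (A ω) ∂μ = (((n : ℝ) + 1) ^ 2)⁻¹ := by
      rw [← h.measureReal_pair n u v, ← integral_indicator_one (hAm (measurableSet_singleton _))]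
      congr 1
      funext ω
      simp [hψ, Set.indicator_apply, hA]
    have h3 : ∫ ω, f ω u v * ψ u v (A ω) ∂μ = (∫ ω, f ω u v ∂μ) * ∫ ω, ψ u v (A ω) ∂μ := h1
    rw [h3, h2, mul_comm]
  simp only [e]
  rw [integral_const_mul, integral_finsetSum _ fun u _ => integrable_finsetSum _ fun v _ => hψi u v,
    integral_finsetSum _ fun u _ => integrable_finsetSum _ fun v _ => h.integrable (hfuv u v),
    Finset.mul_sum]
  refine Finset.sum_congr rfl fun u _ => ?_
  rw [integral_finsetSum _ fun v _ => hψi u v,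
    integral_finsetSum _ fun v _ => h.integrable (hfuv u v), Finset.mul_sum]
  exact Finset.sum_congr rfl fun v _ => key u v

end IsRandomChoice
end RandomChoice

/-! ### Moments of the degrees and almost sure convergence -/

section GraphProcess

variable {Ω : Type*} {U V : (n : ℕ) → Ω → Fin (n + 1)}

/-- The random graph after `n` steps. -/
def randomGraph (U V : (n : ℕ) → Ω → Fin (n + 1)) (n : ℕ) (ω : Ω) : SimpleGraph (Fin (n + 1)) :=
  graph (fun k => U k ω) (fun k => V k ω) n

lemma dependsOnPast_randomGraph (n : ℕ) : DependsOnPast U V n (randomGraph U V n) := by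
  induction n with
  | zero => exact fun _ _ _ => rfl
  | succ n ih => exact (ih.comp fun G => step G).step

/-- The sum of the degrees after `n` steps. -/
noncomputable def degreeSum (U V : (n : ℕ) → Ω → Fin (n + 1)) (n : ℕ) (ω : Ω) : ℝ :=
  degSum (randomGraph U V n ω) fun k => (k : ℝ)

/-- The sum of the squares of the degrees after `n` steps. -/
noncomputable def degreeSqSum (U V : (n : ℕ) → Ω → Fin (n + 1)) (n : ℕ) (ω : Ω) : ℝ :=
  degSum (randomGraph U V n ω) fun k => (k : ℝ) ^ 2

lemma dependsOnPast_degreeSum (n : ℕ) : DependsOnPast U V n (degreeSum U V n) :=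
  (dependsOnPast_randomGraph n).comp fun G => degSum G _

lemma dependsOnPast_degreeSqSum (n : ℕ) : DependsOnPast U V n (degreeSqSum U V n) :=
  (dependsOnPast_randomGraph n).comp fun G => degSum G _

/-- The number of vertices of degree `d` after the next step, averaged over the choices made in
that step. -/
noncomputable def expectedCount (U V : (n : ℕ) → Ω → Fin (n + 1)) (d n : ℕ) (ω : Ω) : ℝ :=
  (((n : ℝ) + 1) ^ 2)⁻¹ * ∑ u, ∑ v, shiftedCount (step (randomGraph U V n ω) u v) (d + 1)

/-- The martingale difference of the number of vertices of degree `d`. -/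
noncomputable def noise (U V : (n : ℕ) → Ω → Fin (n + 1)) (d n : ℕ) (ω : Ω) : ℝ :=
  shiftedCount (randomGraph U V (n + 1) ω) (d + 1) - expectedCount U V d n ω

lemma dependsOnPast_expectedCount (d n : ℕ) : DependsOnPast U V n (expectedCount U V d n) :=
  (dependsOnPast_randomGraph n).comp fun G =>
    (((n : ℝ) + 1) ^ 2)⁻¹ * ∑ u, ∑ v, shiftedCount (step G u v) (d + 1)

lemma dependsOnPast_noise (d n : ℕ) : DependsOnPast U V (n + 1) (noise U V d n) :=
  ((dependsOnPast_randomGraph (n + 1)).comp fun G => shiftedCount G (d + 1)).comp₂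
    ((dependsOnPast_expectedCount d n).mono n.le_succ) (· - ·)

lemma degreeSum_zero (ω : Ω) : degreeSum U V 0 ω = 0 := by
  simp [degreeSum, degSum, deg, randomGraph, graph]

lemma degreeSqSum_zero (ω : Ω) : degreeSqSum U V 0 ω = 0 := by
  simp [degreeSqSum, degSum, deg, randomGraph, graph]

variable [MeasurableSpace Ω] {μ : Measure Ω} [IsProbabilityMeasure μ]

namespace IsRandomChoice

lemma integral_randomGraph_succ (h : IsRandomChoice μ U V) (n : ℕ)
    (F : SimpleGraph (Fin (n + 2)) → ℝ) :
    ∫ ω, F (randomGraph U V (n + 1) ω) ∂μ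
      = ∫ ω, (((n : ℝ) + 1) ^ 2)⁻¹ * ∑ u, ∑ v, F (step (randomGraph U V n ω) u v) ∂μ :=
  h.integral_step (f := fun ω u v => F (step (randomGraph U V n ω) u v))
    ((dependsOnPast_randomGraph n).comp fun G u v => F (step G u v))

lemma integral_degreeSum (h : IsRandomChoice μ U V) (n : ℕ) :
    ∫ ω, degreeSum U V n ω ∂μ = 2 * n := by
  induction n with
  | zero => simp [degreeSum_zero]
  | succ n ih =>
    have e := h.integral_randomGraph_succ n fun G => degSum G fun k => (k : ℝ)
    simp only [sum_degSum_step_id] at e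
    have hn : ((n : ℝ) + 1) ^ 2 ≠ 0 := by positivity
    push_cast at e
    simp only [inv_mul_cancel_left₀ hn] at e
    have e' : ∫ ω, degreeSum U V (n + 1) ω ∂μ = ∫ ω, (degreeSum U V n ω + 2) ∂μ := e
    rw [e', integral_add (h.integrable (dependsOnPast_degreeSum n)) (integrable_const _), ih]
    simp
    ring

/-- Each step adds at most `6 / (n + 1) * 2n + 3 ≤ 15` to the mean. -/
lemma integral_degreeSqSum_le (h : IsRandomChoice μ U V) (n : ℕ) :
    ∫ ω, degreeSqSum U V n ω ∂μ ≤ 15 * n := by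
  induction n with
  | zero => simp [degreeSqSum_zero]
  | succ n ih =>
    have e : ∫ ω, degreeSqSum U V (n + 1) ω ∂μ = _ :=
      h.integral_randomGraph_succ n fun G => degSum G fun k => (k : ℝ) ^ 2
    have hn : (0 : ℝ) < (n : ℝ) + 1 := by positivity
    have i1 := h.integrable (dependsOnPast_degreeSqSum (U := U) (V := V) n)
    have i2 := (h.integrable (dependsOnPast_degreeSum (U := U) (V := V) n)).const_mul
      (6 / ((n : ℝ) + 1))
    have i3 : Integrable (fun ω => 6 / ((n : ℝ) + 1) * degreeSum U V n ω + 3) μ :=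
      i2.add (integrable_const _)
    have hle : ∫ ω, degreeSqSum U V (n + 1) ω ∂μ
        ≤ ∫ ω, (degreeSqSum U V n ω + (6 / ((n : ℝ) + 1) * degreeSum U V n ω + 3)) ∂μ := by
      rw [e]
      refine integral_mono (h.integrable ((dependsOnPast_randomGraph n).comp fun G =>
        (((n : ℝ) + 1) ^ 2)⁻¹ * ∑ u, ∑ v, degSum (step G u v) fun k => (k : ℝ) ^ 2))
        (i1.add i3) fun ω => ?_
      have := sum_degSum_step_sq_le (randomGraph U V n ω)
      push_cast at this
      beta_reduce
      rw [inv_mul_le_iff₀ (by positivity)]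
      refine this.trans (le_of_eq ?_)
      simp only [degreeSqSum, degreeSum]
      field_simp
    rw [integral_add i1 i3, integral_add i2 (integrable_const _), integral_const_mul,
      h.integral_degreeSum] at hle
    have h2 : 6 / ((n : ℝ) + 1) * (2 * n) ≤ 12 := by
      rw [div_mul_eq_mul_div, div_le_iff₀ hn]; linarith
    simp at hle
    push_cast
    linarith

/-- The mean of the ratio is of order `1 / n`, which is not summable. Its square is, by
Cauchy–Schwarz and the bound on squared degrees. -/
lemma ae_tendsto_degreeSum_div_sq (h : IsRandomChoice μ U V) :
    ∀ᵐ ω ∂μ, Tendsto (fun n : ℕ => degreeSum U V n ω / ((n : ℝ) + 1) ^ 2) atTop (𝓝 0) := by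
  have hdep : ∀ n : ℕ, DependsOnPast U V n fun ω => (degreeSum U V n ω / ((n : ℝ) + 1) ^ 2) ^ 2 :=
    fun n => (dependsOnPast_degreeSum n).comp fun y => (y / ((n : ℝ) + 1) ^ 2) ^ 2
  have hE : ∀ n : ℕ, ∫ ω, (degreeSum U V n ω / ((n : ℝ) + 1) ^ 2) ^ 2 ∂μ
      ≤ 15 / ((n : ℝ) + 1) ^ 2 := by
    intro n
    have hle : ∫ ω, (degreeSum U V n ω / ((n : ℝ) + 1) ^ 2) ^ 2 ∂μ
        ≤ ∫ ω, (((n : ℝ) + 1) ^ 3)⁻¹ * degreeSqSum U V n ω ∂μ := by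
      refine integral_mono (h.integrable (hdep n))
        ((h.integrable (dependsOnPast_degreeSqSum n)).const_mul _) fun ω => ?_
      have := sq_degSum_le (randomGraph U V n ω)
      push_cast at this
      simp only [degreeSum, degreeSqSum, div_pow]
      rw [div_le_iff₀ (by positivity)]
      refine this.trans (le_of_eq ?_)
      field_simp
    rw [integral_const_mul] at hle
    refine hle.trans ?_
    rw [inv_mul_le_iff₀ (by positivity)]
    refine (h.integral_degreeSqSum_le n).trans ?_
    rw [mul_div_assoc', le_div_iff₀ (by positivity)]
    have : (0 : ℝ) ≤ 15 * ((n : ℝ) + 1) ^ 2 := by positivity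
    linarith
  have hsum : Summable fun n : ℕ => ∫ ω, (degreeSum U V n ω / ((n : ℝ) + 1) ^ 2) ^ 2 ∂μ :=
    Summable.of_nonneg_of_le (fun n => integral_nonneg fun ω => sq_nonneg _) hE
      (summable_const_div_add_one_sq _)
  filter_upwards [ae_tendsto_zero_of_summable_integral (fun n ω => sq_nonneg _)
    (fun n => h.integrable (hdep n)) hsum] with ω hω
  have := hω.sqrt
  simp only [Real.sqrt_sq_eq_abs, Real.sqrt_zero] at this
  exact (tendsto_zero_iff_abs_tendsto_zero _).2 this

/-- Given the past, the earlier noise is fixed and the new one averages to zero. -/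
lemma integral_sum_noise_mul (h : IsRandomChoice μ U V) (d n : ℕ) :
    ∫ ω, (∑ k ∈ Finset.range n, noise U V d k ω) * noise U V d n ω ∂μ = 0 := by
  have hS : DependsOnPast U V n fun ω => ∑ k ∈ Finset.range n, noise U V d k ω :=
    DependsOnPast.sum fun k hk => (dependsOnPast_noise d k).mono (Finset.mem_range.1 hk)
  have e := h.integral_step (n := n)
    (f := fun ω u v => (∑ k ∈ Finset.range n, noise U V d k ω) *
      (shiftedCount (step (randomGraph U V n ω) u v) (d + 1) - expectedCount U V d n ω))
    (hS.comp₂ ((dependsOnPast_randomGraph n).comp₂ (dependsOnPast_expectedCount d n) Prod.mk)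
      fun S p u v => S * (shiftedCount (step p.1 u v) (d + 1) - p.2))
  refine e.trans ?_
  have hz : ∀ ω, (((n : ℝ) + 1) ^ 2)⁻¹ * ∑ u, ∑ v, (∑ k ∈ Finset.range n, noise U V d k ω) *
      (shiftedCount (step (randomGraph U V n ω) u v) (d + 1) - expectedCount U V d n ω) = 0 := by
    intro ω
    simp only [← Finset.mul_sum, Finset.sum_sub_distrib]
    simp [expectedCount]
    right; right
    field_simp
    ring
  simp only [hz, integral_zero]

lemma integral_noise_sq_le (h : IsRandomChoice μ U V) (d n : ℕ) :
    ∫ ω, noise U V d n ω ^ 2 ∂μ ≤ 117 := by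
  have e := h.integral_step (n := n)
    (f := fun ω u v => (shiftedCount (step (randomGraph U V n ω) u v) (d + 1)
      - expectedCount U V d n ω) ^ 2)
    ((dependsOnPast_randomGraph n).comp₂ (dependsOnPast_expectedCount d n)
      fun G y u v => (shiftedCount (step G u v) (d + 1) - y) ^ 2)
  have hn : (0 : ℝ) < (n : ℝ) + 1 := by positivity
  have i1 := (h.integrable (dependsOnPast_degreeSqSum (U := U) (V := V) n)).const_mul
    (6 / ((n : ℝ) + 1))
  have hle : ∫ ω, noise U V d n ω ^ 2 ∂μ
      ≤ ∫ ω, (6 / ((n : ℝ) + 1) * degreeSqSum U V n ω + 27) ∂μ := by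
    refine e.le.trans (integral_mono (h.integrable
      ((dependsOnPast_randomGraph n).comp₂ (dependsOnPast_expectedCount d n)
      fun G y => (((n : ℝ) + 1) ^ 2)⁻¹ * ∑ u, ∑ v, (shiftedCount (step G u v) (d + 1) - y) ^ 2))
      (i1.add (integrable_const _)) fun ω => ?_)
    have h1 := sum_sum_sq_shiftedCount_step_sub_le (randomGraph U V n ω) d
    push_cast at h1
    beta_reduce
    rw [inv_mul_le_iff₀ (by positivity)]
    -- The variance about the mean is at most the mean square about any other point, here the
    -- current count.
    have h2 : ∑ u, ∑ v, (shiftedCount (step (randomGraph U V n ω) u v) (d + 1)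
        - shiftedCount (randomGraph U V n ω) (d + 1)) ^ 2
        = ∑ u, ∑ v, (shiftedCount (step (randomGraph U V n ω) u v) (d + 1)
          - expectedCount U V d n ω) ^ 2
        + ((n : ℝ) + 1) ^ 2 * (expectedCount U V d n ω
          - shiftedCount (randomGraph U V n ω) (d + 1)) ^ 2 := by
      have h3 : ∑ u, ∑ v, shiftedCount (step (randomGraph U V n ω) u v) (d + 1)
          = ((n : ℝ) + 1) ^ 2 * expectedCount U V d n ω := by
        rw [expectedCount, mul_inv_cancel_left₀ (by positivity)]
      simp only [sub_sq, Finset.sum_add_distrib, Finset.sum_sub_distrib, ← Finset.sum_mul,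
        ← Finset.mul_sum, h3]
      simp
      ring
    have h4 : 0 ≤ ((n : ℝ) + 1) ^ 2 * (expectedCount U V d n ω
          - shiftedCount (randomGraph U V n ω) (d + 1)) ^ 2 := by positivity
    have h5 : ((n : ℝ) + 1) ^ 2 * (6 / ((n : ℝ) + 1) * degreeSqSum U V n ω + 27)
        = ((n : ℝ) + 1) * (6 * degreeSqSum U V n ω + 27 * (n + 1)) := by
      field_simp
    rw [h5]
    unfold degreeSqSum
    linarith
  rw [integral_add i1 (integrable_const _), integral_const_mul] at hle
  -- `6 * 15 = 90`, and `90 + 27 = 117`.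
  have h2 : 6 / ((n : ℝ) + 1) * ∫ ω, degreeSqSum U V n ω ∂μ ≤ 90 := by
    rw [div_mul_eq_mul_div, div_le_iff₀ hn]
    linarith [h.integral_degreeSqSum_le n]
  simp at hle
  linarith

lemma ae_tendsto_sum_noise_div (h : IsRandomChoice μ U V) (d : ℕ) :
    ∀ᵐ ω ∂μ, Tendsto (fun n : ℕ => (∑ k ∈ Finset.range n, noise U V d k ω) / ((n : ℝ) + 1)) atTop
      (𝓝 0) :=
  ae_tendsto_sum_div_of_orthogonal (fun n => h.memLp (dependsOnPast_noise d n) 2)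
    (h.integral_noise_sq_le d) (h.integral_sum_noise_mul d)

lemma ae_tendsto_shiftedCount_div (h : IsRandomChoice μ U V) {s : ℕ → ℝ} (hs0 : s 0 = 1)
    (hs : ∀ j, s j ∈ Set.Icc (0 : ℝ) 1)
    (hrec : ∀ d : ℕ, s (d + 1) = ((d : ℝ) + 1) / (2 * d + 3) * (s d + s (d + 2))) :
    ∀ᵐ ω ∂μ, ∀ j, Tendsto (fun n : ℕ => shiftedCount (randomGraph U V n ω) j / ((n : ℝ) + 1))
      atTop (𝓝 (s j)) := by
  filter_upwards [ae_all_iff.2 h.ae_tendsto_sum_noise_div, h.ae_tendsto_degreeSum_div_sq]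
    with ω hM hS j
  refine tendsto_of_perturbed_recursion (x := fun j n => shiftedCount (randomGraph U V n ω) j)
    (e := fun d n => expectedCount U V d n ω - shiftedCount (randomGraph U V n ω) (d + 1)
      - (d + 1) * (shiftedCount (randomGraph U V n ω) d + shiftedCount (randomGraph U V n ω) (d + 2)
        - 2 * shiftedCount (randomGraph U V n ω) (d + 1)) / (n + 1))
    (M := fun d n => ∑ k ∈ Finset.range n, noise U V d k ω) hs0 hs hrec (fun n => ?_)
    (fun j n => shiftedCount_nonneg _ j) (fun j n => ?_) (fun d => ?_) hM (fun d n => ?_) j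
  · simp [shiftedCount_zero]
  · simpa using shiftedCount_le (randomGraph U V n ω) j
  · have hbound : Tendsto (fun n : ℕ => degreeSum U V n ω / ((n : ℝ) + 1) ^ 2
        + (1 + 4 * ((d : ℝ) + 2) ^ 2) * (1 / ((n : ℝ) + 1))) atTop (𝓝 0) := by
      simpa using hS.add (tendsto_one_div_add_atTop_nhds_zero_nat.const_mul
        (1 + 4 * ((d : ℝ) + 2) ^ 2))
    refine squeeze_zero_norm (fun n => ?_) hbound
    have := abs_drift_le (randomGraph U V n ω) d
    push_cast at this
    refine this.trans (le_of_eq ?_)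
    unfold degreeSum
    field_simp
  · simp only [Finset.sum_range_succ, noise]
    ring

end IsRandomChoice
end GraphProcess
end DuplicationDeletion

theorem theorem1 :
    ∃ c : ℕ → ℝ,
      (∀ d : ℕ, 0 < c d) ∧
      c 0 = (1 + c 1) / 3 ∧
      (∀ d : ℕ, 1 ≤ d →
        c d = ((d : ℝ) + 1) / (2 * (d : ℝ) + 3) * (c (d - 1) + c (d + 1))) ∧
      ∀ (Ω : Type*) [MeasurableSpace Ω] (μ : Measure Ω) [IsProbabilityMeasure μ]
        (U V : (n : ℕ) → Ω → Fin (n + 1)),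
        DuplicationDeletion.IsRandomChoice μ U V →
        ∀ d : ℕ, ∀ᵐ ω ∂μ,
          Tendsto (fun n : ℕ => (DuplicationDeletion.X U V n d ω : ℝ) / ((n : ℝ) + 1))
            atTop (𝓝 (c d)) := by
  obtain ⟨s, hs0, hs, hrec⟩ := DuplicationDeletion.exists_stationary
  have hpos : ∀ j, 0 < s j := by
    intro j
    induction j with
    | zero => rw [hs0]; exact one_pos
    | succ d ih =>
      rw [hrec d]
      exact mul_pos (by positivity) (add_pos_of_pos_of_nonneg ih (hs (d + 2)).1)
  -- Undo the index shift: the equation for `c 0` is the recursion at `d = 0` with `s 0 = 1`.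
  refine ⟨fun d => s (d + 1), fun d => hpos _, ?_, fun d hd => ?_, ?_⟩
  · have := hrec 0
    simp only [hs0] at this
    norm_num at this ⊢
    linarith
  · obtain ⟨k, rfl⟩ := Nat.exists_eq_add_of_le' hd
    exact hrec (k + 1)
  · intro Ω _ μ _ U V h d
    filter_upwards [h.ae_tendsto_shiftedCount_div hs0 hs hrec] with ω hω
    have := hω (d + 1)
    simp only [DuplicationDeletion.shiftedCount_succ] at this
    exact this
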